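/- Let $\mathcal H$ be a real Hilbert space and let $f,\{f_k\}_{k\ge 1}\colon\mathcal H\to\mathbb R$ be continuous convex functions. For a continuous convex $g\colon\mathcal H\to\mathbb R$ let $\mathcal C_g=\arg\min g$ denote its (possibly empty) set of global minimizers, let $\partial g(x)=\{v\in\mathcal H:\ g(y)-g(x)\ge\langle v,y-x\rangle\ \text{for all } y\in\mathcal H\}$ denote its subdifferential at $x$, and let $s_g(x)=\operatorname{dist}(0,\partial g(x))$ denote its slope at $x$. Suppose that $\mathcal C_{f_k}\neq\emptyset$ for all $k\ge 1$ and that the set $$\mathcal C:=\mathcal C_f\cup\bigcup_{k\ge1}\mathcal C_{f_k}$$ is bounded. Assume further that (i) $s_{f_k}$ converges to $s_f$ uniformly on every bounded subset of $\mathcal H$, and (ii) $f_k$ converges to $f$ uniformly on $\mathcal C$. Then $f_k$ converges to $f$ uniformly on every bounded subset of $\mathcal H$. -/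

import Mathlib

open Filter

/-- The convex subdifferential of `f` at `x`:
all `v` with `f y - f x ≥ ⟪v, y - x⟫` for every `y`. -/
def convexSubdifferential {H : Type*} [NormedAddCommGroup H] [InnerProductSpace ℝ H]
    (f : H → ℝ) (x : H) : Set H :=
  {v | ∀ y : H, f y - f x ≥ inner ℝ v (y - x)}

/-- The slope `s_f(x) = dist(0, ∂f(x))`. The subdifferential of a continuous convex function
`f : H → ℝ` is nonempty at every point, so for such `f` this is the true distance. -/
noncomputable def convexSlope {H : Type*} [NormedAddCommGroup H] [InnerProductSpace ℝ H]
    (f : H → ℝ) (x : H) : ℝ :=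
  Metric.infDist 0 (convexSubdifferential f x)

/-- The set of global minimizers of `f`. -/
def minimizers {H : Type*} (f : H → ℝ) : Set H :=
  {x | IsMinOn f Set.univ x}

/-!
Let `ε` bound `|s_F - s_g|` on a large ball, and let `v` be the element of least norm of `∂g(x)`,
so that `‖v‖ = s_g(x)`. A short step from `x` to `y = x - t • v` lowers `g` by nearly
`‖v‖ * ‖x - y‖` and lowers `F` by at most `s_F(x) * ‖x - y‖`; hence `F - g` at `x` exceeds its
value at `y` by at most `2 * ε * ‖x - y‖`. Along a chain of such steps the loss is `2 * ε` times the
length of the chain, so everything rests on a length bound that is uniform in the starting point,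
although `g` may be unbounded on bounded sets. Chains are produced by an Ekeland-type argument
(`exists_mem_of_descent`), in which a potential controls the length; no gradient flow is needed.

* While `g` exceeds a bound `M` for `g` on some ball of centre `p` and radius `r`, the subgradient
  inequality on that ball gives `⟪v, x - p⟫ ≥ r * ‖v‖`, so `‖x - p‖ ^ 2 / r` is a potential and the
  length is at most `R ^ 2 / r` (`exists_mem_sublevel_sub_le`). Continuity of `g` lets `M` be taken
  close to the minimal value.
* Once `g` is nearly minimal, `2 * g / σ` is a potential as long as `s_g > σ`, and the chain has
  length at most `1` (`exists_convexSlope_le_sub_le`). At its end both slopes are small, so `F` and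
  `g` are close to their values at a common near-minimizer `c`.

Thus `F - g ≤ F c - g c` up to a small error (`sub_le_of_convexSlope_le`). With `c` a minimizer of
`f_k`, whose slope for `f` is small, this is used for `(F, g) = (f_k, f)` first. The resulting upper
bound for `f_k` provides a ball, independent of `k`, on which `f_k` is nearly minimal, and this
permits the use for `(F, g) = (f, f_k)`. The centre of the ball is a minimizer of one fixed
`f_{k₀}`, so existence of a minimizer of `f` is never needed.
-/

/-! ### Subgradients of least norm -/

section Subgradients

variable {H : Type*} [NormedAddCommGroup H] [InnerProductSpace ℝ H]

/-- Sandwich form of the Hahn–Banach theorem: a convex subset `S` of the hypograph of `g` that touches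
the graph at `(x, g x)` lies below the affine minorant of `g` given by some subgradient at `x`. -/
theorem exists_mem_convexSubdifferential_above [CompleteSpace H] {g : H → ℝ}
    (hg : ConvexOn ℝ Set.univ g) (hc : Continuous g) {S : Set (H × ℝ)} (hS : Convex ℝ S) {x : H}
    (hxS : (x, g x) ∈ S) (hle : ∀ q ∈ S, q.2 ≤ g q.1) :
    ∃ w ∈ convexSubdifferential g x, ∀ q ∈ S, q.2 - g x ≤ inner ℝ w (q.1 - x) := by
  have hconv : Convex ℝ {q : H × ℝ | g q.1 < q.2} := by
    simpa using hg.convex_strict_epigraph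
  have hopen : IsOpen {q : H × ℝ | g q.1 < q.2} :=
    isOpen_lt (hc.comp continuous_fst) continuous_snd
  have hdisj : Disjoint {q : H × ℝ | g q.1 < q.2} S :=
    Set.disjoint_left.2 fun q hq hqS => absurd (hle q hqS) (not_le.2 hq)
  obtain ⟨φ, u, hφA, hφS⟩ := geometric_hahn_banach_open hconv hopen hS hdisj
  set l : H →L[ℝ] ℝ := φ.comp (ContinuousLinearMap.inl ℝ H ℝ) with hl
  set α : ℝ := φ (0, 1) with hα
  have hφ : ∀ y s, φ (y, s) = l y + α * s := by
    intro y s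
    have : ((y, s) : H × ℝ) = (y, 0) + s • ((0, 1) : H × ℝ) := by simp
    rw [this, map_add, map_smul, hl, hα]
    simp [mul_comm]
  have hux : u ≤ l x + α * g x := by rw [← hφ]; exact hφS _ hxS
  -- The separating hyperplane is not vertical, because `(x, g x + 1)` is strictly on one side.
  have hα0 : α < 0 := by
    have h1 : φ (x, g x + 1) < u := hφA _ (by simp)
    rw [hφ] at h1
    linarith
  have hgu : ∀ y, l y + α * g y ≤ u := by
    intro y
    refine le_of_forall_pos_le_add fun ε hε => ?_
    have h1 : φ (y, g y + ε / (-α)) < u :=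
      hφA _ (by simpa using div_pos hε (neg_pos.2 hα0))
    rw [hφ] at h1
    have h2 : α * (ε / (-α)) = -ε := by field_simp [hα0.ne]
    linarith [mul_add α (g y) (ε / (-α))]
  set w : H := (-α)⁻¹ • (InnerProductSpace.toDual ℝ H).symm l with hw
  have hwi : ∀ y, inner ℝ w y = (-α)⁻¹ * l y := by
    intro y
    rw [hw, real_inner_smul_left, InnerProductSpace.toDual_symm_apply]
  have hpos : 0 < -α := neg_pos.2 hα0
  refine ⟨w, fun y => ?_, fun q hq => ?_⟩
  · rw [hwi, map_sub, ge_iff_le, inv_mul_le_iff₀ hpos]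
    linarith [hgu y]
  · have h1 : u ≤ φ (q.1, q.2) := hφS _ hq
    rw [hφ] at h1
    rw [hwi, map_sub, le_inv_mul_iff₀ hpos]
    linarith [hgu x]

theorem convex_convexSubdifferential (g : H → ℝ) (x : H) :
    Convex ℝ (convexSubdifferential g x) := by
  intro v hv w hw a b ha hb hab y
  have h1 := mul_le_mul_of_nonneg_left (hv y) ha
  have h2 := mul_le_mul_of_nonneg_left (hw y) hb
  rw [inner_add_left, real_inner_smul_left, real_inner_smul_left]
  have h3 : g y - g x = a * (g y - g x) + b * (g y - g x) := by rw [← add_mul, hab, one_mul]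
  linarith

theorem isClosed_convexSubdifferential (g : H → ℝ) (x : H) :
    IsClosed (convexSubdifferential g x) := by
  simp only [convexSubdifferential, Set.ofPred_forall]
  exact isClosed_iInter fun y =>
    isClosed_le (continuous_id.inner continuous_const) continuous_const

theorem exists_minimal_subgradient [CompleteSpace H] {g : H → ℝ}
    (hg : ConvexOn ℝ Set.univ g) (hc : Continuous g) (x : H) :
    ∃ v ∈ convexSubdifferential g x, ‖v‖ = convexSlope g x ∧
      ∀ w ∈ convexSubdifferential g x, ‖v‖ ^ 2 ≤ inner ℝ v w := by
  obtain ⟨w₀, hw₀, -⟩ := exists_mem_convexSubdifferential_above hg hc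
    (convex_singleton (x, g x)) rfl (by simp)
  have hne : (convexSubdifferential g x).Nonempty := ⟨w₀, hw₀⟩
  obtain ⟨v, hv, hmin⟩ := exists_norm_eq_iInf_of_complete_convex hne
    (isClosed_convexSubdifferential g x).isComplete (convex_convexSubdifferential g x) 0
  rw [norm_eq_iInf_iff_real_inner_le_zero (convex_convexSubdifferential g x) hv] at hmin
  have hinner : ∀ w ∈ convexSubdifferential g x, ‖v‖ ^ 2 ≤ inner ℝ v w := by
    intro w hw
    have := hmin w hw
    rw [zero_sub, inner_neg_left, inner_sub_right, real_inner_self_eq_norm_sq] at this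
    linarith
  refine ⟨v, hv, le_antisymm ?_ ?_, hinner⟩
  · refine (Metric.le_infDist hne).2 fun w hw => ?_
    rw [dist_zero_left]
    have h1 := (hinner w hw).trans (real_inner_le_norm v w)
    by_contra! hlt
    nlinarith [norm_nonneg w, norm_nonneg v]
  · simpa [convexSlope] using Metric.infDist_le_dist_of_mem (x := (0 : H)) hv

/-- The slope at `x` bounds the decrease of `g` away from `x`, globally and not only to first order. -/
theorem sub_le_convexSlope_mul [CompleteSpace H] {g : H → ℝ}
    (hg : ConvexOn ℝ Set.univ g) (hc : Continuous g) (x y : H) :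
    g x - g y ≤ convexSlope g x * ‖x - y‖ := by
  obtain ⟨v, hv, hvs, -⟩ := exists_minimal_subgradient hg hc x
  have h1 := hv y
  have h2 := real_inner_le_norm v (x - y)
  rw [← neg_sub x y, inner_neg_right] at h1
  rw [← hvs]
  linarith

theorem convexSlope_eq_zero_of_mem_minimizers {g : H → ℝ} {x : H} (hx : x ∈ minimizers g) :
    convexSlope g x = 0 := by
  have h0 : (0 : H) ∈ convexSubdifferential g x := fun y => by
    have : g x ≤ g y := hx (Set.mem_univ y)
    simpa using this
  exact Metric.infDist_zero_of_mem h0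

/-- The one-sided derivative of `g` at `x` in the direction `-v`, for `v` the subgradient of least
norm, is at most `-‖v‖ ^ 2`. Otherwise the sandwich theorem, applied to a ray of too small a slope
in the direction `-v`, gives a subgradient `w` with `⟪v, w⟫ < ‖v‖ ^ 2`. -/
theorem eventually_descent_along_minimal_subgradient [CompleteSpace H] {g : H → ℝ}
    (hg : ConvexOn ℝ Set.univ g) (hc : Continuous g) {x v : H}
    (hmin : ∀ w ∈ convexSubdifferential g x, ‖v‖ ^ 2 ≤ inner ℝ v w) {η : ℝ} (hη : 0 < η) :
    ∀ᶠ t in nhdsWithin (0 : ℝ) (Set.Ioi 0),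
      g (x - t • v) ≤ g x - t * (‖v‖ ^ 2 - η) := by
  obtain ⟨t₀, ht₀, hgt₀⟩ : ∃ t : ℝ, 0 < t ∧ g (x - t • v) < g x - t * (‖v‖ ^ 2 - η) := by
    by_contra! hcon
    -- The ray through `(x, g x)` in the direction `(-v, -(‖v‖ ^ 2 - η))`.
    set S : Set (H × ℝ) :=
      (fun t : ℝ => ((x - t • v, g x - t * (‖v‖ ^ 2 - η)) : H × ℝ)) '' Set.Ici 0 with hS
    have hSconv : Convex ℝ S := by
      rintro _ ⟨s, hs, rfl⟩ _ ⟨t, ht, rfl⟩ a b ha hb hab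
      refine ⟨a * s + b * t, add_nonneg (mul_nonneg ha hs) (mul_nonneg hb ht), ?_⟩
      obtain rfl : b = 1 - a := by linarith
      ext
      · simp only [Prod.fst_add, Prod.smul_fst]
        module
      · simp only [Prod.snd_add, Prod.smul_snd, smul_eq_mul]
        ring
    have hxS : (x, g x) ∈ S := ⟨0, Set.self_mem_Ici, by simp⟩
    have hle : ∀ q ∈ S, q.2 ≤ g q.1 := by
      rintro _ ⟨t, ht, rfl⟩
      rcases eq_or_lt_of_le (show (0 : ℝ) ≤ t from ht) with rfl | ht
      · simp
      · exact hcon t ht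
    obtain ⟨w, hw, hwS⟩ := exists_mem_convexSubdifferential_above hg hc hSconv hxS hle
    have h1 := hwS _ ⟨1, Set.mem_Ici.2 zero_le_one, rfl⟩
    have h2 := hmin w hw
    simp only [one_smul, one_mul, sub_sub_cancel_left, inner_neg_right] at h1
    rw [real_inner_comm] at h2
    linarith
  -- By convexity the estimate at `t₀` passes to all smaller `t`.
  filter_upwards [Ioc_mem_nhdsGT ht₀] with t ht
  have hs0 : 0 ≤ t / t₀ := (div_pos ht.1 ht₀).le
  have hs1 : t / t₀ ≤ 1 := (div_le_one ht₀).2 ht.2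
  have hst : t / t₀ * t₀ = t := div_mul_cancel₀ _ ht₀.ne'
  have hcv := hg.2 (Set.mem_univ x) (Set.mem_univ (x - t₀ • v)) (sub_nonneg.2 hs1) hs0
    (sub_add_cancel _ _)
  have hpt : (1 - t / t₀) • x + (t / t₀) • (x - t₀ • v) = x - t • v := by
    rw [smul_sub, smul_smul, hst]
    module
  rw [hpt, smul_eq_mul, smul_eq_mul] at hcv
  have h3 := mul_le_mul_of_nonneg_left hgt₀.le hs0
  have h4 : t / t₀ * (g x - t₀ * (‖v‖ ^ 2 - η)) = t / t₀ * g x - t * (‖v‖ ^ 2 - η) := by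
    rw [mul_sub, ← mul_assoc, hst]
  linarith

/-- A short step against the subgradient of `g` of least norm loses at most `2 * ε` times its length
in `F - g`. -/
theorem eventually_sub_le_sub_add_of_convexSlope_le [CompleteSpace H] {F g : H → ℝ}
    (hF : ConvexOn ℝ Set.univ F) (hFc : Continuous F)
    (hg : ConvexOn ℝ Set.univ g) (hgc : Continuous g) {x v : H}
    (hmin : ∀ w ∈ convexSubdifferential g x, ‖v‖ ^ 2 ≤ inner ℝ v w) (hv : 0 < ‖v‖) {ε : ℝ}
    (hε : 0 < ε) (hs : convexSlope F x ≤ ‖v‖ + ε) :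
    ∀ᶠ t in nhdsWithin (0 : ℝ) (Set.Ioi 0),
      F x - g x ≤ F (x - t • v) - g (x - t • v) + 2 * ε * ‖t • v‖ := by
  filter_upwards [eventually_descent_along_minimal_subgradient hg hgc hmin (mul_pos hε hv),
    self_mem_nhdsWithin] with t h1 ht
  have h2 := sub_le_convexSlope_mul hF hFc x (x - t • v)
  have ht : 0 < t := ht
  rw [sub_sub_cancel] at h2
  have h3 := mul_le_mul_of_nonneg_right hs (norm_nonneg (t • v))
  have h4 : ‖t • v‖ = t * ‖v‖ := by rw [norm_smul, Real.norm_of_nonneg ht.le]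
  rw [h4] at h2 h3 ⊢
  linarith

end Subgradients

/-! ### An Ekeland-type descent principle -/

section Descent

/-- If every point reachable from `x₀` and outside `S` admits a further step, then `S` is reachable
from `x₀`. Here `y` is reachable from `x` when `dist x y ≤ h x - h y` and no `ψ i` increases from
`x` to `y`: the potential `h` pays for the distance. This relation is closed, reflexive and
transitive, so nearly minimizing `h` at each step yields a Cauchy sequence whose limit admits no
further step. -/
theorem exists_mem_of_descent {X ι : Type*} [MetricSpace X] [CompleteSpace X] {h : X → ℝ}
    {ψ : ι → X → ℝ} (hh : Continuous h) (hψ : ∀ i, Continuous (ψ i)) {S : Set X} (x₀ : X) {b : ℝ}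
    (hb : ∀ x, dist x₀ x ≤ h x₀ - h x → b ≤ h x)
    (hstep : ∀ x, dist x₀ x ≤ h x₀ - h x → (∀ i, ψ i x ≤ ψ i x₀) → x ∉ S →
      ∃ y, y ≠ x ∧ dist x y ≤ h x - h y ∧ ∀ i, ψ i y ≤ ψ i x) :
    ∃ x ∈ S, dist x₀ x ≤ h x₀ - h x ∧ ∀ i, ψ i x ≤ ψ i x₀ := by
  set A : X → Set X := fun x => {y | dist x y ≤ h x - h y ∧ ∀ i, ψ i y ≤ ψ i x} with hA
  have hrefl : ∀ x, x ∈ A x := fun x => by simp [hA]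
  have htrans : ∀ {x y z}, y ∈ A x → z ∈ A y → z ∈ A x := fun {x y z} hy hz =>
    ⟨(dist_triangle x y z).trans (by linarith [hy.1, hz.1]), fun i => (hz.2 i).trans (hy.2 i)⟩
  have hclosed : ∀ x, IsClosed (A x) := by
    intro x
    have : A x = {y | dist x y ≤ h x - h y} ∩ ⋂ i, {y | ψ i y ≤ ψ i x} := by
      ext y; simp [hA]
    rw [this]
    exact (isClosed_le (continuous_const.dist continuous_id) (continuous_const.sub hh)).inter
      (isClosed_iInter fun i => isClosed_le (hψ i) continuous_const)
  have hbdd : ∀ x ∈ A x₀, BddBelow (h '' A x) := by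
    rintro x hx
    refine ⟨b, ?_⟩
    rintro _ ⟨y, hy, rfl⟩
    exact hb y (htrans hx hy).1
  have hnext : ∀ (n : ℕ) (x : X), ∃ y ∈ A x, h y < sInf (h '' A x) + (1 / 2) ^ n := by
    intro n x
    obtain ⟨_, ⟨y, hy, rfl⟩, hlt⟩ := exists_lt_of_csInf_lt (⟨h x, x, hrefl x, rfl⟩ :
      (h '' A x).Nonempty) (lt_add_of_pos_right (sInf (h '' A x)) (by positivity :
        (0 : ℝ) < (1 / 2) ^ n))
    exact ⟨y, hy, hlt⟩
  choose next hnextA hnextlt using hnext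
  set u : ℕ → X := fun n => Nat.rec x₀ next n with hu
  have hu_succ : ∀ n, u (n + 1) = next n (u n) := fun n => rfl
  have hmono : ∀ n m, n ≤ m → u m ∈ A (u n) := by
    intro n m hnm
    induction m, hnm using Nat.le_induction with
    | base => exact hrefl _
    | succ m _ ih => exact htrans ih (by rw [hu_succ]; exact hnextA m (u m))
  have hu₀ : ∀ n, u n ∈ A x₀ := fun n => hmono 0 n (Nat.zero_le n)
  have hclose : ∀ n, ∀ y ∈ A (u (n + 1)), dist (u (n + 1)) y ≤ (1 / 2) ^ n := by
    intro n y hy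
    have h1 : sInf (h '' A (u n)) ≤ h y := csInf_le (hbdd _ (hu₀ n))
      ⟨y, htrans (hmono n (n + 1) n.le_succ) hy, rfl⟩
    have h2 := hnextlt n (u n)
    rw [← hu_succ] at h2
    linarith [hy.1]
  have hpow : Tendsto (fun n : ℕ => (1 / 2 : ℝ) ^ n) atTop (nhds 0) :=
    tendsto_pow_atTop_nhds_zero_of_lt_one (by norm_num) (by norm_num)
  have hcauchy : CauchySeq fun n => u (n + 1) :=
    cauchySeq_of_le_tendsto_0' (fun n : ℕ => (1 / 2 : ℝ) ^ n)
      (fun n m hnm => hclose n _ (hmono _ _ (Nat.succ_le_succ hnm))) hpow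
  obtain ⟨z, hz⟩ := cauchySeq_tendsto_of_complete hcauchy
  have hzA : ∀ n, z ∈ A (u (n + 1)) := fun n => (hclosed _).mem_of_tendsto hz
    ((eventually_ge_atTop n).mono fun m hm => hmono _ _ (Nat.succ_le_succ hm))
  have hz₀ : z ∈ A x₀ := htrans (hu₀ 1) (hzA 0)
  refine ⟨z, ?_, hz₀⟩
  by_contra hzS
  obtain ⟨y, hyz, hy⟩ := hstep z hz₀.1 hz₀.2 hzS
  have hlim : Tendsto (fun n => u (n + 1)) atTop (nhds y) := by
    rw [tendsto_iff_dist_tendsto_zero]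
    exact squeeze_zero (fun _ => dist_nonneg) (fun n => hclose n y (htrans (hzA n) hy)) hpow
  exact hyz (tendsto_nhds_unique hlim hz)

end Descent

/-! ### Comparison of convex functions with close slopes -/

section Comparison

variable {H : Type*} [NormedAddCommGroup H] [InnerProductSpace ℝ H] [CompleteSpace H]

/-- Descent of `g` from an arbitrary height down to a bound `M` for `g` on a ball of radius `r` about
`p`, with a loss in `F - g` that depends only on the distance to `p` and not on `g x₀`. The
potential is `‖x - p‖ ^ 2 / r`. -/
theorem exists_mem_sublevel_sub_le {F g : H → ℝ}
    (hF : ConvexOn ℝ Set.univ F) (hFc : Continuous F)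
    (hg : ConvexOn ℝ Set.univ g) (hgc : Continuous g) {p x₀ : H} {R r M ε : ℝ} (hr : 0 < r)
    (hε : 0 < ε) (hM : ∀ y ∈ Metric.closedBall p r, g y ≤ M)
    (hs : ∀ x ∈ Metric.closedBall p R, convexSlope F x ≤ convexSlope g x + ε)
    (hx₀ : x₀ ∈ Metric.closedBall p R) :
    ∃ x ∈ Metric.closedBall p R, g x ≤ M ∧
      F x₀ - g x₀ ≤ F x - g x + 2 * ε * (R ^ 2 / r) := by
  have hx₀R : ‖x₀ - p‖ ≤ R := by rwa [← mem_closedBall_iff_norm]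
  set h : H → ℝ := fun x => ‖x - p‖ ^ 2 / r with hh
  have hhc : Continuous h := by fun_prop
  have hnn : ∀ x, 0 ≤ h x := fun x => by positivity
  have hregion : ∀ x, dist x₀ x ≤ h x₀ - h x → x ∈ Metric.closedBall p R := by
    intro x hx
    have h1 : h x ≤ h x₀ := by linarith [dist_nonneg (x := x₀) (y := x)]
    have h2 : ‖x - p‖ ^ 2 ≤ ‖x₀ - p‖ ^ 2 := (div_le_div_iff_of_pos_right hr).1 h1
    rw [mem_closedBall_iff_norm]
    exact (pow_le_pow_iff_left₀ (norm_nonneg _) (norm_nonneg _) two_ne_zero).1 h2 |>.trans hx₀R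
  obtain ⟨x, hxM, hxd, hxψ⟩ := exists_mem_of_descent (ι := Unit)
    (ψ := fun _ x => g x - F x + 2 * ε * h x) hhc (fun _ => by fun_prop) (S := {x | g x ≤ M}) x₀
    (fun x _ => hnn x) (by
      intro x hx _ hxS
      have hxM : M < g x := not_le.1 hxS
      obtain ⟨v, hv, hvs, hmin⟩ := exists_minimal_subgradient hg hgc x
      have hgp : g p ≤ M := hM p (Metric.mem_closedBall_self hr.le)
      have hv0 : 0 < ‖v‖ := by
        rw [norm_pos_iff]
        rintro rfl
        have := hv p
        rw [inner_zero_left] at this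
        linarith
      -- The subgradient inequality at the boundary point `p + (r / ‖v‖) • v` of the ball.
      have hinner : r * ‖v‖ ≤ inner ℝ v (x - p) := by
        have h1 : g (p + (r / ‖v‖) • v) ≤ M := hM _ (by
          rw [mem_closedBall_iff_norm, add_sub_cancel_left, norm_smul, norm_div, norm_norm,
            Real.norm_of_nonneg hr.le, div_mul_cancel₀ _ hv0.ne'])
        have h2 := hv (p + (r / ‖v‖) • v)
        rw [show p + (r / ‖v‖) • v - x = (r / ‖v‖) • v - (x - p) by abel, inner_sub_right,
          real_inner_smul_right, real_inner_self_eq_norm_sq] at h2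
        have h3 : r / ‖v‖ * ‖v‖ ^ 2 = r * ‖v‖ := by field_simp
        linarith
      have hsx : convexSlope F x ≤ ‖v‖ + ε := hvs ▸ hs x (hregion x hx)
      obtain ⟨t, hdesc, ht0, htr⟩ :=
        ((eventually_sub_le_sub_add_of_convexSlope_le hF hFc hg hgc hmin hv0 hε hsx).and
          (Ioc_mem_nhdsGT (div_pos hr hv0))).exists
      have htv : t * ‖v‖ ≤ r := (le_div_iff₀ hv0).1 htr
      have hnorm : ‖t • v‖ = t * ‖v‖ := by rw [norm_smul, Real.norm_of_nonneg ht0.le]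
      have hdist : dist x (x - t • v) = ‖t • v‖ := by rw [dist_eq_norm, sub_sub_cancel]
      have hle : dist x (x - t • v) ≤ h x - h (x - t • v) := by
        rw [hdist, hnorm, hh]
        simp only
        rw [← sub_div, le_div_iff₀ hr,
          show x - t • v - p = (x - p) - t • v by abel, norm_sub_sq_real (x - p) (t • v),
          real_inner_smul_right, real_inner_comm, hnorm]
        have h4 := mul_le_mul_of_nonneg_left hinner ht0.le
        have h5 := mul_le_mul_of_nonneg_left htv (mul_pos ht0 hv0).le
        nlinarith
      refine ⟨x - t • v, ?_, hle, fun _ => ?_⟩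
      · rw [ne_eq, sub_eq_self, smul_eq_zero]
        exact not_or.2 ⟨ht0.ne', norm_pos_iff.1 hv0⟩
      · have h6 := mul_le_mul_of_nonneg_left hle (mul_pos two_pos hε).le
        rw [hdist] at h6
        linarith)
  refine ⟨x, hregion x hxd, hxM, ?_⟩
  have h1 := hxψ ()
  have h2 : h x₀ ≤ R ^ 2 / r :=
    div_le_div_of_nonneg_right (pow_le_pow_left₀ (norm_nonneg _) hx₀R 2) hr.le
  have h3 := mul_le_mul_of_nonneg_left h2 (mul_pos two_pos hε).le
  have h4 := mul_nonneg (mul_pos two_pos hε).le (hnn x)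
  linarith

/-- Descent of `g` from a point where it is nearly minimal to a point where its slope is at most `σ`,
by a chain of length at most `1`. The potential is `2 * g / σ`. The lower bound `hm` for `g` is
allowed to deteriorate linearly, so that a near-minimizer `p` of `g` can be used. -/
theorem exists_convexSlope_le_sub_le {F g : H → ℝ}
    (hF : ConvexOn ℝ Set.univ F) (hFc : Continuous F)
    (hg : ConvexOn ℝ Set.univ g) (hgc : Continuous g) {p x₀ : H} {R T m e σ ε : ℝ}
    (hε : 0 < ε) (hσ : 0 < σ) (hTσ : 8 * T ≤ σ) (he : 0 ≤ e) (heσ : 4 * e ≤ σ)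
    (heT : e * (R + 1) ≤ T) (hm : ∀ y, m ≤ g y + e * ‖y - p‖)
    (hs : ∀ x ∈ Metric.closedBall p (R + 1), convexSlope F x ≤ convexSlope g x + ε)
    (hx₀ : x₀ ∈ Metric.closedBall p R) (hgx₀ : g x₀ ≤ m + T) :
    ∃ x ∈ Metric.closedBall p (R + 1), convexSlope g x ≤ σ ∧
      F x₀ - g x₀ ≤ F x - g x + 2 * ε := by
  have hx₀R : dist x₀ p ≤ R := hx₀
  set h : H → ℝ := fun x => 2 / σ * g x with hh
  have hhc : Continuous h := by fun_prop
  have hσh : ∀ x, σ * h x = 2 * g x := fun x => by rw [hh]; field_simp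
  -- The linear error in `hm` is absorbed because `4 * e ≤ σ`; this gives `dist x₀ x ≤ 1`.
  have hregion : ∀ x, dist x₀ x ≤ h x₀ - h x → x ∈ Metric.closedBall p (R + 1) := by
    intro x hx
    have h1 := mul_le_mul_of_nonneg_left hx hσ.le
    rw [mul_sub, hσh, hσh] at h1
    have h2 : ‖x - p‖ ≤ dist x₀ x + R := by
      rw [← dist_eq_norm]
      linarith [dist_triangle_left x p x₀]
    have h3 := mul_le_mul_of_nonneg_left h2 he
    have h4 := mul_le_mul_of_nonneg_right heσ (dist_nonneg (x := x₀) (y := x))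
    have h5 : σ * dist x₀ x ≤ σ * 1 := by linarith [hm x]
    have h6 := le_of_mul_le_mul_left h5 hσ
    rw [Metric.mem_closedBall]
    linarith [dist_triangle_left x p x₀]
  have hlow : ∀ x ∈ Metric.closedBall p (R + 1), m - T ≤ g x := by
    intro x hx
    rw [mem_closedBall_iff_norm] at hx
    linarith [hm x, mul_le_mul_of_nonneg_left hx he]
  -- At slope above `σ`, half of the first-order decrease of `g` already exceeds `σ / 2` per length.
  obtain ⟨x, hxσ, hxd, hxψ⟩ := exists_mem_of_descent (ι := Unit)
    (ψ := fun _ x => g x - F x + 2 * ε * h x) hhc (fun _ => by fun_prop)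
    (S := {x | convexSlope g x ≤ σ}) x₀ (b := 2 / σ * (m - T))
    (fun x hx => mul_le_mul_of_nonneg_left (hlow x (hregion x hx)) (div_pos two_pos hσ).le) (by
      intro x hx _ hxS
      obtain ⟨v, -, hvs, hmin⟩ := exists_minimal_subgradient hg hgc x
      have hvσ : σ < ‖v‖ := hvs ▸ not_le.1 hxS
      have hv0 : 0 < ‖v‖ := hσ.trans hvσ
      have hsx : convexSlope F x ≤ ‖v‖ + ε := hvs ▸ hs x (hregion x hx)
      obtain ⟨t, ⟨hdesc, hgt⟩, ht0⟩ :=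
        (((eventually_sub_le_sub_add_of_convexSlope_le hF hFc hg hgc hmin hv0 hε hsx).and
          (eventually_descent_along_minimal_subgradient hg hgc hmin
            (half_pos (pow_pos hv0 2)))).and self_mem_nhdsWithin).exists
      have ht0 : 0 < t := ht0
      have hnorm : ‖t • v‖ = t * ‖v‖ := by rw [norm_smul, Real.norm_of_nonneg ht0.le]
      have hdist : dist x (x - t • v) = ‖t • v‖ := by rw [dist_eq_norm, sub_sub_cancel]
      have hle : dist x (x - t • v) ≤ h x - h (x - t • v) := by
        refine le_of_mul_le_mul_left ?_ hσ
        rw [mul_sub, hσh, hσh, hdist, hnorm]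
        have := mul_le_mul_of_nonneg_right hvσ.le (mul_pos ht0 hv0).le
        linarith
      refine ⟨x - t • v, ?_, hle, fun _ => ?_⟩
      · rw [ne_eq, sub_eq_self, smul_eq_zero]
        exact not_or.2 ⟨ht0.ne', norm_pos_iff.1 hv0⟩
      · have h6 := mul_le_mul_of_nonneg_left hle (mul_pos two_pos hε).le
        rw [hdist] at h6
        linarith)
  refine ⟨x, hregion x hxd, hxσ, ?_⟩
  have h1 := hxψ ()
  have h2 : h x₀ - h x ≤ 1 := by
    refine le_of_mul_le_mul_left ?_ hσ
    rw [mul_sub, hσh, hσh]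
    have h0 : 0 ≤ T := (mul_nonneg he (by linarith [dist_nonneg.trans hx₀R])).trans heT
    linarith [hlow x (hregion x hxd)]
  have h3 := mul_le_mul_of_nonneg_left h2 (mul_pos two_pos hε).le
  linarith

/-- The comparison estimate: an upper bound for `F - g` at `x₀` by its value at a near-minimizer `c`
of `g`. -/
theorem sub_le_of_convexSlope_le {F g : H → ℝ}
    (hF : ConvexOn ℝ Set.univ F) (hFc : Continuous F)
    (hg : ConvexOn ℝ Set.univ g) (hgc : Continuous g) {p c x₀ : H} {R r T m e σ ε B : ℝ}
    (hr : 0 < r) (hε : 0 < ε) (hσ : 0 < σ) (hTσ : 8 * T ≤ σ) (he : 0 ≤ e) (heσ : 4 * e ≤ σ)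
    (heT : e * (R + 1) ≤ T) (hm : ∀ y, m ≤ g y + e * ‖y - p‖)
    (hM : ∀ y ∈ Metric.closedBall p r, g y ≤ m + T)
    (hs : ∀ x ∈ Metric.closedBall p (R + 1), convexSlope F x ≤ convexSlope g x + ε)
    (hB : ∀ x ∈ Metric.closedBall p (R + 1), ‖x - c‖ ≤ B) (hc : convexSlope g c ≤ ε)
    (hx₀ : x₀ ∈ Metric.closedBall p R) :
    F x₀ - g x₀ ≤ F c - g c + ε * (2 * (R ^ 2 / r) + 2 + 2 * B) + σ * B := by
  obtain ⟨x₁, hx₁, hgx₁, h1⟩ := exists_mem_sublevel_sub_le hF hFc hg hgc hr hε hM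
    (fun x hx => hs x (Metric.closedBall_subset_closedBall (by linarith) hx)) hx₀
  obtain ⟨x₂, hx₂, hσ₂, h2⟩ := exists_convexSlope_le_sub_le hF hFc hg hgc hε hσ hTσ he heσ heT
    hm hs hx₁ hgx₁
  have hB₂ := hB x₂ hx₂
  have h3 := sub_le_convexSlope_mul hF hFc x₂ c
  have h4 := sub_le_convexSlope_mul hg hgc c x₂
  rw [norm_sub_rev] at h4
  have h5 : convexSlope F x₂ * ‖x₂ - c‖ ≤ (σ + ε) * B :=
    mul_le_mul ((hs x₂ hx₂).trans (by linarith)) hB₂ (norm_nonneg _) (by positivity)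
  have h6 : convexSlope g c * ‖x₂ - c‖ ≤ ε * B :=
    mul_le_mul hc hB₂ (norm_nonneg _) hε.le
  linarith

/-- The comparison estimate on the ball of radius `D` about `0`, with `R = 2 * D`,
`σ = δ / (10 * D)` and `T = σ / 8`: the points met stay within `5 * D` of `0` and of `c`. -/
theorem sub_le_of_convexSlope_le_on_closedBall {F g : H → ℝ}
    (hF : ConvexOn ℝ Set.univ F) (hFc : Continuous F)
    (hg : ConvexOn ℝ Set.univ g) (hgc : Continuous g) {p c : H} {D r m e δ ε : ℝ}
    (hD : 1 ≤ D) (hr : 0 < r) (hδ : 0 < δ) (hε : 0 < ε)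
    (hεδ : ε * (8 * D ^ 2 / r + 3 + 10 * D) ≤ δ / 2) (he : 0 ≤ e)
    (heδ : e * (2 * D + 1) ≤ δ / (80 * D)) (hp : ‖p‖ ≤ D) (hcD : ‖c‖ ≤ D)
    (hm : ∀ y, m ≤ g y + e * ‖y - p‖)
    (hM : ∀ y ∈ Metric.closedBall p r, g y ≤ m + δ / (80 * D))
    (hs : ∀ x ∈ Metric.closedBall 0 (5 * D), convexSlope F x ≤ convexSlope g x + ε)
    (hc : convexSlope g c ≤ ε) (hFgc : F c - g c ≤ ε) {x : H} (hx : ‖x‖ ≤ D) :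
    F x - g x ≤ δ := by
  have hD0 : 0 < D := one_pos.trans_le hD
  have hT : 8 * (δ / (80 * D)) = δ / (10 * D) := by field_simp; norm_num
  have heσ : 4 * e ≤ δ / (10 * D) := by
    have := le_mul_of_one_le_right he (show 1 ≤ 2 * D + 1 by linarith)
    linarith [show 0 < δ / (80 * D) by positivity]
  have hnorm : ∀ y ∈ Metric.closedBall p (2 * D + 1), ‖y - p‖ ≤ 2 * D + 1 := fun y hy => by
    rwa [← mem_closedBall_iff_norm]
  have key := sub_le_of_convexSlope_le hF hFc hg hgc (p := p) (c := c) (x₀ := x) (R := 2 * D)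
    (B := 5 * D) hr hε (by positivity : 0 < δ / (10 * D)) hT.le he heσ heδ hm hM
    (fun y hy => hs y (by
      rw [mem_closedBall_zero_iff]
      linarith [hnorm y hy, norm_le_norm_sub_add y p]))
    (fun y hy => by
      have h1 := norm_sub_le_norm_sub_add_norm_sub y p c
      have h2 := norm_sub_le p c
      linarith [hnorm y hy])
    hc (by
      rw [mem_closedBall_iff_norm]
      linarith [norm_sub_le x p])
  have h1 : δ / (10 * D) * (5 * D) = δ / 2 := by field_simp; norm_num
  have h2 : ε * (8 * D ^ 2 / r + 3 + 10 * D) =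
      ε + ε * (2 * ((2 * D) ^ 2 / r) + 2 + 2 * (5 * D)) := by ring
  linarith

/-- A minimizer of `fk k` for a single suitable `k` is a near-minimizer of `f`, and `f` is nearly
minimal on a whole ball about it. -/
theorem exists_ball_near_minimum {f : H → ℝ} {fk : ℕ → H → ℝ}
    (hf : ConvexOn ℝ Set.univ f) (hfc : Continuous f) {c : ℕ → H}
    (hc : ∀ k, c k ∈ minimizers (fk k))
    (hs : ∀ ε > 0, ∀ᶠ k in atTop, convexSlope f (c k) ≤ convexSlope (fk k) (c k) + ε)
    {e T : ℝ} (he : 0 < e) (hT : 0 < T) :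
    ∃ k, ∃ r, 0 < r ∧ r ≤ 1 ∧ (∀ y, f (c k) ≤ f y + e * ‖y - c k‖) ∧
      ∀ y ∈ Metric.closedBall (c k) r, f y ≤ f (c k) + T := by
  obtain ⟨k, hk⟩ := (hs e he).exists
  rw [convexSlope_eq_zero_of_mem_minimizers (hc k), zero_add] at hk
  have hnear : ∀ᶠ y in nhds (c k), f y ≤ f (c k) + T :=
    (hfc.tendsto (c k)).eventually_le_const (lt_add_of_pos_right _ hT)
  obtain ⟨r, hr, hball⟩ := Metric.nhds_basis_closedBall.eventually_iff.1 hnear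
  refine ⟨k, min r 1, lt_min hr one_pos, min_le_right _ _, fun y => ?_, fun y hy =>
    hball (Metric.closedBall_subset_closedBall (min_le_left _ _) hy)⟩
  have h1 := sub_le_convexSlope_mul hf hfc (c k) y
  have h2 := mul_le_mul_of_nonneg_right hk (norm_nonneg (c k - y))
  rw [norm_sub_rev y]
  linarith

/-! ### Uniform convergence -/

theorem eventually_abs_sub_le {f : H → ℝ} {fk : ℕ → H → ℝ}
    (hf : ConvexOn ℝ Set.univ f) (hfc : Continuous f)
    (hfk : ∀ k, ConvexOn ℝ Set.univ (fk k)) (hfkc : ∀ k, Continuous (fk k)) {c : ℕ → H}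
    (hc : ∀ k, c k ∈ minimizers (fk k)) {D : ℝ} (hD : 1 ≤ D) (hcD : ∀ k, ‖c k‖ + 1 ≤ D)
    (hs : ∀ ε > 0, ∀ᶠ k in atTop, ∀ x ∈ Metric.closedBall (0 : H) (5 * D),
      |convexSlope f x - convexSlope (fk k) x| < ε)
    (hval : ∀ ε > 0, ∀ᶠ k in atTop, |f (c k) - fk k (c k)| < ε) {δ : ℝ} (hδ : 0 < δ) :
    ∀ᶠ k in atTop, ∀ x, ‖x‖ ≤ D → |f x - fk k x| ≤ δ := by
  have hD0 : 0 < D := one_pos.trans_le hD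
  have hcD' : ∀ k, ‖c k‖ ≤ D := fun k => by linarith [hcD k]
  have hcmem : ∀ k, c k ∈ Metric.closedBall (0 : H) (5 * D) := fun k => by
    rw [mem_closedBall_zero_iff]
    linarith [hcD' k]
  have hs' : ∀ ε > 0, ∀ᶠ k in atTop, convexSlope f (c k) ≤ convexSlope (fk k) (c k) + ε :=
    fun ε hε => (hs ε hε).mono fun k hk => by linarith [(abs_lt.1 (hk _ (hcmem k))).2]
  have hexists : ∀ δ > 0, ∃ p : H, ∃ r, 0 < r ∧ r ≤ 1 ∧ ‖p‖ + 1 ≤ D ∧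
      (∀ y, f p ≤ f y + δ / (80 * D) / (4 * (2 * D + 1)) * ‖y - p‖) ∧
      ∀ y ∈ Metric.closedBall p r, f y ≤ f p + δ / (80 * D) / 4 := by
    intro δ hδ
    obtain ⟨k, r, hr, hr1, h1, h2⟩ := exists_ball_near_minimum hf hfc hc hs'
      (by positivity : 0 < δ / (80 * D) / (4 * (2 * D + 1)))
      (by positivity : 0 < δ / (80 * D) / 4)
    exact ⟨c k, r, hr, hr1, hcD k, h1, h2⟩
  have hconst : ∀ δ : ℝ, δ / (80 * D) / (4 * (2 * D + 1)) * (2 * D + 1) = δ / (80 * D) / 4 := by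
    intro δ
    field_simp
  have hupper : ∀ δ > 0, ∀ᶠ k in atTop, ∀ x, ‖x‖ ≤ D → fk k x - f x ≤ δ := by
    intro δ hδ
    obtain ⟨p, r, hr, -, hp, hm, hM⟩ := hexists δ hδ
    have hT : 0 < δ / (80 * D) := by positivity
    set K := 8 * D ^ 2 / r + 3 + 10 * D
    have hK0 : 0 < K := by positivity
    have hε : 0 < δ / 2 / K := by positivity
    filter_upwards [hs _ hε, hval _ hε] with k hsk hvk x hx
    refine sub_le_of_convexSlope_le_on_closedBall (hfk k) (hfkc k) hf hfc hD hr hδ hε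
      (div_mul_cancel₀ _ hK0.ne').le (by positivity) (by rw [hconst]; linarith)
      (by linarith) (hcD' k) hm (fun y hy => (hM y hy).trans (by linarith))
      (fun y hy => by linarith [(abs_lt.1 (hsk y hy)).1]) ?_ (by linarith [(abs_lt.1 hvk).1]) hx
    have := (abs_lt.1 (hsk _ (hcmem k))).2
    rw [convexSlope_eq_zero_of_mem_minimizers (hc k)] at this
    linarith
  -- Four errors of size `T / 4` separate `fk k` on the ball about `p` from its minimum: the upper
  -- bound `hupper`, the oscillation of `f` on the ball, `f p - f (c k)`, and `f (c k) - fk k (c k)`.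
  have hlower : ∀ᶠ k in atTop, ∀ x, ‖x‖ ≤ D → f x - fk k x ≤ δ := by
    obtain ⟨p, r, hr, hr1, hp, hm, hM⟩ := hexists δ hδ
    have hT : 0 < δ / (80 * D) := by positivity
    set T := δ / (80 * D)
    set K := 8 * D ^ 2 / r + 3 + 10 * D
    have hK0 : 0 < K := by positivity
    have hε : 0 < min (δ / 2 / K) (T / 4) := by positivity
    filter_upwards [hs _ hε, hval _ hε, hupper (T / 4) (by positivity)] with k hsk hvk huk x hx
    have hpc : f p ≤ f (c k) + T / 4 := by
      have h1 : ‖c k - p‖ ≤ 2 * D + 1 := by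
        linarith [norm_sub_le (c k) p, hcD' k]
      have h2 := mul_le_mul_of_nonneg_left h1
        (by positivity : 0 ≤ T / (4 * (2 * D + 1)))
      linarith [hm (c k), hconst δ]
    refine sub_le_of_convexSlope_le_on_closedBall hf hfc (hfk k) (hfkc k) (p := p)
      (e := 0) (m := fk k (c k)) hD hr hδ hε
      ((le_div_iff₀ hK0).1 (min_le_left _ _)) le_rfl (by rw [zero_mul]; exact hT.le)
      (by linarith) (hcD' k) (fun y => ?_) (fun y hy => ?_)
      (fun y hy => by linarith [(abs_lt.1 (hsk y hy)).2]) ?_ (abs_lt.1 hvk).2.le hx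
    · rw [zero_mul, add_zero]
      exact hc k (Set.mem_univ y)
    · have hyD : ‖y‖ ≤ D := by
        rw [mem_closedBall_iff_norm] at hy
        linarith [norm_le_norm_sub_add y p]
      have h3 := (abs_lt.1 hvk).2.trans_le (min_le_right _ _)
      linarith [huk y hyD, hM y hy]
    · rw [convexSlope_eq_zero_of_mem_minimizers (hc k)]
      exact hε.le
  filter_upwards [hupper δ hδ, hlower] with k h1 h2 x hx
  exact abs_le.2 ⟨by linarith [h1 x hx], h2 x hx⟩

end Comparison

theorem corollary3p3 {H : Type*} [NormedAddCommGroup H] [InnerProductSpace ℝ H] [CompleteSpace H]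
    (f : H → ℝ) (fk : ℕ → H → ℝ)
    (hf_convex : ConvexOn ℝ Set.univ f) (hf_cont : Continuous f)
    (hfk_convex : ∀ k, ConvexOn ℝ Set.univ (fk k)) (hfk_cont : ∀ k, Continuous (fk k))
    (hfk_min : ∀ k, (minimizers (fk k)).Nonempty)
    (hC_bdd : Bornology.IsBounded (minimizers f ∪ ⋃ k, minimizers (fk k)))
    (h_slope : ∀ U : Set H, Bornology.IsBounded U →
      TendstoUniformlyOn (fun k => convexSlope (fk k)) (convexSlope f) atTop U)
    (h_val : TendstoUniformlyOn fk f atTop (minimizers f ∪ ⋃ k, minimizers (fk k))) :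
    ∀ U : Set H, Bornology.IsBounded U → TendstoUniformlyOn fk f atTop U := by

  intro U hU
  choose c hc using hfk_min
  obtain ⟨D₁, hD₁⟩ := hU.subset_closedBall 0
  obtain ⟨D₂, hD₂⟩ := hC_bdd.subset_closedBall 0
  set D := max D₁ (max (D₂ + 1) 1) with hD
  have hcC : ∀ k, c k ∈ minimizers f ∪ ⋃ k, minimizers (fk k) := fun k =>
    Or.inr (Set.mem_iUnion.2 ⟨k, hc k⟩)
  have hcD : ∀ k, ‖c k‖ + 1 ≤ D := fun k => by
    have h1 := mem_closedBall_zero_iff.1 (hD₂ (hcC k))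
    have h2 : D₂ + 1 ≤ D := (le_max_left _ _).trans (le_max_right _ _)
    linarith
  have hs := Metric.tendstoUniformlyOn_iff.1
    (h_slope (Metric.closedBall 0 (5 * D)) Metric.isBounded_closedBall)
  have hv := Metric.tendstoUniformlyOn_iff.1 h_val
  rw [Metric.tendstoUniformlyOn_iff]
  intro δ hδ
  filter_upwards [eventually_abs_sub_le hf_convex hf_cont hfk_convex hfk_cont hc
    ((le_max_right _ _).trans (le_max_right _ _)) hcD hs
    (fun ε hε => (hv ε hε).mono fun k hk => hk _ (hcC k)) (half_pos hδ)] with k hk x hx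
  rw [Real.dist_eq]
  exact (hk x ((mem_closedBall_zero_iff.1 (hD₁ hx)).trans (le_max_left _ _))).trans_lt
    (half_lt_self hδ)
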